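/- Let $R$ be an associative ring with $1$ and $M$ a nonzero unital right $R$-module. An $m\times n$ matrix $A$ over $R$ acts on the right on row vectors, giving a homomorphism of abelian groups $M^m\to M^n$, $x\mapsto xA$. For square matrices $A,B$ write $A\oplus B=\begin{pmatrix}A&0\\0&B\end{pmatrix}$; if $A$ and $B$ have the same size and agree except in their $r$-th row (respectively column), let their determinantal sum $A\nabla B$ with respect to that row (column) be the matrix which agrees with them in all other rows (columns) and has as its $r$-th row (column) the sum of those of $A$ and $B$. For a set $\mathcal P$ of square matrices over $R$ consider the following conditions: 1. $\mathcal P$ contains every $n\times n$ matrix ($n>0$) which is a product of an $n\times(n-1)$ matrix and an $(n-1)\times n$ matrix over $R$ (a non-full matrix); 2. if $A\in\mathcal P$ and $B$ is any square matrix over $R$, then $A\oplus B\in\mathcal P$; 3. if $A,B\in\mathcal P$ agree except in the $r$-th column, then their determinantal sum with respect to that column is in $\mathcal P$; 4. if $A,B\in\mathcal P$ agree except in the $r$-th row, then their determinantal sum with respect to that row is in $\mathcal P$; 5. if $A\oplus 1\in\mathcal P$, where $1$ is the $1\times1$ identity matrix, then $A\in\mathcal P$; 6. the $1\times 1$ matrix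 $1$ is not in $\mathcal P$; 7. if $A\oplus B\in\mathcal P$, then $A\in\mathcal P$ or $B\in\mathcal P$. A set satisfying 1–7 is called a prime matrix ideal of $R$. Now let $\mathcal P$ be the set of those square matrices $A$ over $R$ (of all sizes $n\times n$, $n\ge 0$) for which the map $M^n\to M^n$ given by $A$ is not surjective. Then: (i) $\mathcal P$ satisfies 2, 5, 6 and 7, and for each $n$ the set of $n\times n$ matrices in $\mathcal P$ is closed under right multiplication by the matrices $I_n\pm e_{ij}$ $(i\ne j)$. (ii) $\mathcal P$ satisfies 1 if and only if $(*)$ for every $n>0$, no $(n-1)\times n$ matrix over $R$ induces a surjection $M^{n-1}\to M^n$. (iii) $\mathcal P$ satisfies 4 if the following condition holds: $(**)$ whenever $n>0$ and $I\subseteq M^n$ is the image of $M^{n-1}$ under the action of an $(n-1)\times n$ matrix over $R$, then either (a) every map $M\to M^n$ which is given by a row vector of length $n$ over $R$ and has image not contained in $I$ has image which together with $I$ spans the additive group $M^n$, or (b) no such map has image which together with $I$ spans $M^n$. Thus, if both $(*)$ and $(**)$ hold, then $\mathcal P$ is a prime matrix ideal of $R$. If, further, $Mr=M$ for every nonzero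 $r\in R$, then $R$ is embeddable in a division ring. -/

import Mathlib

universe u v

namespace PrimeMatrixIdeals

open MulOpposite

/-! Sets of square matrices over a ring -/

section SquareMatrixSets

variable {R : Type u} [Ring R]

/-- A set of square matrices (of all sizes `n ≥ 0`) over `R`, given by its `n × n` members
for each `n`. -/
abbrev SquareMatrixSet (R : Type u) : Type u :=
  (n : ℕ) → Set (Matrix (Fin n) (Fin n) R)

/-- The diagonal sum `A ⊕ B`, i.e. the block matrix `(A 0; 0 B)`. -/
def diagSum {m n : ℕ} (A : Matrix (Fin m) (Fin m) R) (B : Matrix (Fin n) (Fin n) R) :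
    Matrix (Fin (m + n)) (Fin (m + n)) R :=
  Matrix.reindex finSumFinEquiv finSumFinEquiv (Matrix.fromBlocks A 0 0 B)

/-- `A` and `B` agree except possibly in the `r`-th column. -/
def AgreeOffCol {n : ℕ} (A B : Matrix (Fin n) (Fin n) R) (r : Fin n) : Prop :=
  ∀ i j, j ≠ r → A i j = B i j

/-- `A` and `B` agree except possibly in the `r`-th row. -/
def AgreeOffRow {n : ℕ} (A B : Matrix (Fin n) (Fin n) R) (r : Fin n) : Prop :=
  ∀ i j, i ≠ r → A i j = B i j

/-- The determinantal sum `A ∇ B` with respect to the `r`-th column. -/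
def nablaCol {n : ℕ} (A B : Matrix (Fin n) (Fin n) R) (r : Fin n) :
    Matrix (Fin n) (Fin n) R :=
  A.updateCol r (fun i => A i r + B i r)

/-- The determinantal sum `A ∇ B` with respect to the `r`-th row. -/
def nablaRow {n : ℕ} (A B : Matrix (Fin n) (Fin n) R) (r : Fin n) :
    Matrix (Fin n) (Fin n) R :=
  A.updateRow r (fun j => A r j + B r j)

/-- `P` contains every non-full matrix, i.e. every `N × N` matrix (`N = n + 1 > 0`) that is a
product of an `N × (N - 1)` matrix and an `(N - 1) × N` matrix. -/
def ContainsNonfull (P : SquareMatrixSet R) : Prop :=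
  ∀ (n : ℕ) (B : Matrix (Fin (n + 1)) (Fin n) R) (C : Matrix (Fin n) (Fin (n + 1)) R),
    B * C ∈ P (n + 1)

/-- If `A ∈ P` and `B` is any square matrix, then `A ⊕ B ∈ P`. -/
def ClosedDiagSum (P : SquareMatrixSet R) : Prop :=
  ∀ (m n : ℕ) (A : Matrix (Fin m) (Fin m) R) (B : Matrix (Fin n) (Fin n) R),
    A ∈ P m → diagSum A B ∈ P (m + n)

/-- `P` is closed under determinantal sums with respect to columns. -/
def ClosedNablaCol (P : SquareMatrixSet R) : Prop :=
  ∀ (n : ℕ) (A B : Matrix (Fin n) (Fin n) R) (r : Fin n),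
    AgreeOffCol A B r → A ∈ P n → B ∈ P n → nablaCol A B r ∈ P n

/-- `P` is closed under determinantal sums with respect to rows. -/
def ClosedNablaRow (P : SquareMatrixSet R) : Prop :=
  ∀ (n : ℕ) (A B : Matrix (Fin n) (Fin n) R) (r : Fin n),
    AgreeOffRow A B r → A ∈ P n → B ∈ P n → nablaRow A B r ∈ P n

/-- If `A ⊕ 1 ∈ P`, where `1` is the `1 × 1` identity matrix, then `A ∈ P`. -/
def CancelsOne (P : SquareMatrixSet R) : Prop :=
  ∀ (n : ℕ) (A : Matrix (Fin n) (Fin n) R),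
    diagSum A (1 : Matrix (Fin 1) (Fin 1) R) ∈ P (n + 1) → A ∈ P n

/-- The `1 × 1` matrix `1` is not in `P`. -/
def OmitsOne (P : SquareMatrixSet R) : Prop :=
  (1 : Matrix (Fin 1) (Fin 1) R) ∉ P 1

/-- If `A ⊕ B ∈ P` then `A ∈ P` or `B ∈ P`. -/
def PrimeDiagSum (P : SquareMatrixSet R) : Prop :=
  ∀ (m n : ℕ) (A : Matrix (Fin m) (Fin m) R) (B : Matrix (Fin n) (Fin n) R),
    diagSum A B ∈ P (m + n) → A ∈ P m ∨ B ∈ P n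

/-- `P` is closed under right multiplication by the matrices `I ± e_{ij}`, `i ≠ j`. -/
def ClosedRightElementary (P : SquareMatrixSet R) : Prop :=
  ∀ (n : ℕ) (A : Matrix (Fin n) (Fin n) R) (i j : Fin n), i ≠ j → A ∈ P n →
    A * (1 + Matrix.single i j (1 : R)) ∈ P n ∧ A * (1 - Matrix.single i j (1 : R)) ∈ P n

/-- Matrix ideals in the sense of P. M. Cohn. -/
structure IsMatrixIdeal (P : SquareMatrixSet R) : Prop where
  containsNonfull : ContainsNonfull P
  closedDiagSum : ClosedDiagSum P
  closedNablaCol : ClosedNablaCol P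
  closedNablaRow : ClosedNablaRow P
  cancelsOne : CancelsOne P

/-- Prime matrix ideals in the sense of P. M. Cohn. -/
structure IsPrimeMatrixIdeal (P : SquareMatrixSet R) : Prop extends IsMatrixIdeal P where
  omitsOne : OmitsOne P
  primeDiagSum : PrimeDiagSum P

end SquareMatrixSets

/-! Matrices acting on powers of a right module (a module over `Rᵐᵒᵖ`) -/

section Action

variable {R : Type u} [Ring R] (M : Type v) [AddCommGroup M] [Module Rᵐᵒᵖ M]

/-- The additive map `M^m → M^n`, `x ↦ x A`, given by an `m × n` matrix `A` acting on the right
on row vectors with entries in the right module `M`: `(x A)_j = ∑ i, x_i A_{ij}`. -/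
def matAct {m n : ℕ} (A : Matrix (Fin m) (Fin n) R) : (Fin m → M) →+ (Fin n → M) where
  toFun x j := ∑ i, op (A i j) • x i
  map_zero' := by
    funext j
    simp
  map_add' x y := by
    funext j
    simp [smul_add, Finset.sum_add_distrib]

/-- The additive map `M → M^n`, `x ↦ x a = (x a_1, …, x a_n)`, given by a row vector `a`. -/
def rowAct {n : ℕ} (a : Fin n → R) : M →+ (Fin n → M) where
  toFun x j := op (a j) • x
  map_zero' := by
    funext j
    simp
  map_add' x y := by
    funext j
    simp [smul_add]

variable (R) in
/-- The square matrices over `R` which act non-surjectively on the corresponding power of `M`. -/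
def nonSurj : SquareMatrixSet R :=
  fun _ => {A | ¬ Function.Surjective (matAct M A)}

variable (R) in
/-- No `(N - 1) × N` matrix over `R` (`N = n + 1 > 0`) induces a surjection `M^(N-1) → M^N`. -/
def NoSurjectionUp : Prop :=
  ∀ (n : ℕ) (C : Matrix (Fin n) (Fin (n + 1)) R), ¬ Function.Surjective (matAct M C)

variable (R) in
/-- For each `(N - 1) × N` matrix `C` over `R` (`N = n + 1 > 0`), with image `I ⊆ M^N`: either
every row-vector map `M → M^N` with image not contained in `I` has image spanning `M^N` together
with `I`, or no such map does. -/
def RowDichotomy : Prop :=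
  ∀ (n : ℕ) (C : Matrix (Fin n) (Fin (n + 1)) R),
    (∀ a : Fin (n + 1) → R, ¬ (rowAct M a).range ≤ (matAct M C).range →
      (rowAct M a).range ⊔ (matAct M C).range = ⊤) ∨
    (∀ a : Fin (n + 1) → R, ¬ (rowAct M a).range ≤ (matAct M C).range →
      (rowAct M a).range ⊔ (matAct M C).range ≠ ⊤)

end Action

/-- `R` is embeddable in a division ring. -/
def EmbedsInDivisionRing (R : Type u) [Ring R] : Prop :=
  ∃ (D : Type u) (_ : DivisionRing D) (f : R →+* D), Function.Injective f

end PrimeMatrixIdeals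

/-! For the matrix ideal, surjectivity of a square matrix is read one row at a time
(`surjective_matAct_iff_sup_eq_top`): a row must span `M^n` together with the image `I` of the
remaining rows. By `(**)`, two rows that fail to do so have a sum that fails as well, which is
closure under row sums. Closure under column sums then follows from closure under row sums by
bordering, with no further use of `(**)`.

The embedding does not pass through the theory of prime matrix ideals; the division ring is built
directly. An `n × (n+1)` matrix `C` with image `I` and rows `x`, `y`, where `y` spans `M^(n+1)`
together with `I`, define a "fraction" as the additive relation `m x - a y ∈ I` between `m` and `a`.
Spanning makes the relation total. Sums and composites are again of this form, by block matrices. If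
`x` maps into `I`, the relation contains the zero map; otherwise `(**)` makes `x` span too, so
exchanging `x` and `y` inverts the relation. Relations sharing a total subrelation are identified,
and the classes form a division ring. An element `r` goes to the graph of `m ↦ m r`, which is
nonzero when `M r = M`. -/

namespace PrimeMatrixIdeals

open MulOpposite

/-! Additive relations on an abelian group -/

section AdditiveRelations

variable {M : Type v} [AddCommGroup M]

/-- The pointwise sum of two additive relations. -/
def relAdd (G H : AddSubgroup (M × M)) : AddSubgroup (M × M) where
  carrier := {p | ∃ a b, (p.1, a) ∈ G ∧ (p.1, b) ∈ H ∧ a + b = p.2}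
  zero_mem' := ⟨0, 0, G.zero_mem, H.zero_mem, add_zero 0⟩
  add_mem' := by
    rintro p q ⟨a, b, ha, hb, h⟩ ⟨c, d, hc, hd, h'⟩
    refine ⟨a + c, b + d, G.add_mem ha hc, H.add_mem hb hd, ?_⟩
    rw [Prod.snd_add, ← h, ← h']
    abel
  neg_mem' := by
    rintro p ⟨a, b, ha, hb, h⟩
    refine ⟨-a, -b, G.neg_mem ha, H.neg_mem hb, ?_⟩
    rw [Prod.snd_neg, ← h]
    abel

/-- The pointwise negative of an additive relation. -/
def relNeg (G : AddSubgroup (M × M)) : AddSubgroup (M × M) where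
  carrier := {p | (p.1, -p.2) ∈ G}
  zero_mem' := by
    change ((0 : M), -(0 : M)) ∈ G
    rw [neg_zero]
    exact G.zero_mem
  add_mem' := by
    intro p q hp hq
    simpa [neg_add, add_comm] using G.add_mem hp hq
  neg_mem' := by
    intro p hp
    simpa using G.neg_mem hp

/-- The composite of two additive relations, the first one being applied first. -/
def relComp (G H : AddSubgroup (M × M)) : AddSubgroup (M × M) where
  carrier := {p | ∃ a, (p.1, a) ∈ G ∧ (a, p.2) ∈ H}
  zero_mem' := ⟨0, G.zero_mem, H.zero_mem⟩
  add_mem' := by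
    rintro p q ⟨a, ha, ha'⟩ ⟨b, hb, hb'⟩
    exact ⟨a + b, G.add_mem ha hb, H.add_mem ha' hb'⟩
  neg_mem' := by
    rintro p ⟨a, ha, ha'⟩
    exact ⟨-a, G.neg_mem ha, H.neg_mem ha'⟩

/-- The inverse of an additive relation. -/
def relInv (G : AddSubgroup (M × M)) : AddSubgroup (M × M) where
  carrier := {p | (p.2, p.1) ∈ G}
  zero_mem' := G.zero_mem
  add_mem' hp hq := G.add_mem hp hq
  neg_mem' hp := G.neg_mem hp

theorem mem_relAdd {G H : AddSubgroup (M × M)} {m c : M} :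
    (m, c) ∈ relAdd G H ↔ ∃ a b, (m, a) ∈ G ∧ (m, b) ∈ H ∧ a + b = c := Iff.rfl

theorem mem_relNeg {G : AddSubgroup (M × M)} {m c : M} :
    (m, c) ∈ relNeg G ↔ (m, -c) ∈ G := Iff.rfl

theorem mem_relComp {G H : AddSubgroup (M × M)} {m c : M} :
    (m, c) ∈ relComp G H ↔ ∃ a, (m, a) ∈ G ∧ (a, c) ∈ H := Iff.rfl

theorem mem_relInv {G : AddSubgroup (M × M)} {m c : M} :
    (m, c) ∈ relInv G ↔ (c, m) ∈ G := Iff.rfl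

@[simp]
theorem mk_mem_graph {f : M →+ M} {m c : M} : (m, c) ∈ f.graph ↔ f m = c :=
  AddMonoidHom.mem_graph

/-- A set of total additive relations, closed under the ring operations, in which every relation
either contains the zero map or has its inverse in the set. -/
structure IsDivisionSystem (S : Set (AddSubgroup (M × M))) : Prop where
  total : ∀ G ∈ S, ∀ m, ∃ a, (m, a) ∈ G
  zero_le_or_inv_mem : ∀ G ∈ S, (∀ m, (m, 0) ∈ G) ∨ relInv G ∈ S
  top_notMem : ⊤ ∉ S
  add_mem : ∀ G ∈ S, ∀ H ∈ S, relAdd G H ∈ S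
  neg_mem : ∀ G ∈ S, relNeg G ∈ S
  comp_mem : ∀ G ∈ S, ∀ H ∈ S, relComp G H ∈ S
  zero_mem : (0 : M →+ M).graph ∈ S
  one_mem : (AddMonoidHom.id M).graph ∈ S

/-! ### The division ring of classes of relations. -/

namespace IsDivisionSystem

variable {S : Set (AddSubgroup (M × M))}

/-- If `G` does not contain the zero map, its inverse is total, so `G`, and hence `T`, reaches every
`d`. Adding pairs `(c - b, 0)` then fills all of `M × M`, contradicting `top_notMem`. This is what
makes the identification of relations transitive. -/
theorem zero_le_of_le (hS : IsDivisionSystem S) {G T : AddSubgroup (M × M)} (hG : G ∈ S)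
    (hT : T ∈ S) (hGT : G ≤ T) (h0 : ∀ m, (m, 0) ∈ T) (m : M) : (m, 0) ∈ G := by
  rcases hS.zero_le_or_inv_mem G hG with h | h
  · exact h m
  · refine absurd hT ?_
    have hT' : T = ⊤ := by
      refine eq_top_iff.2 ?_
      rintro ⟨c, d⟩ -
      obtain ⟨b, hb⟩ := hS.total _ h d
      have := T.add_mem (hGT (mem_relInv.1 hb)) (h0 (c - b))
      simpa using this
    rw [hT']
    exact hS.top_notMem

/-- Two relations are identified when they have a common total subrelation. -/
def setoid (hS : IsDivisionSystem S) : Setoid S where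
  r G H := ∀ m, ∃ a, (m, a) ∈ G.1 ∧ (m, a) ∈ H.1
  iseqv :=
    { refl := fun G m => (hS.total _ G.2 m).imp fun _ h => ⟨h, h⟩
      symm := fun h m => (h m).imp fun _ h => h.symm
      trans := by
        intro G H K hGH hHK m
        have hd : ∀ A B : S, relAdd A.1 (relNeg B.1) ∈ S := fun A B =>
          hS.add_mem _ A.2 _ (hS.neg_mem _ B.2)
        -- `G` and `K` share a value at each `m` exactly when `G - K` contains the zero map. Here `G
        -- - K ≤ (G - H) + (H - K)`, and the right side contains the zero map.
        have key := hS.zero_le_of_le (hd G K) (hS.add_mem _ (hd G H) _ (hd H K)) (by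
          rintro ⟨c, d⟩ ⟨a, b, ha, hb, rfl⟩
          obtain ⟨e, he⟩ := hS.total _ H.2 c
          refine ⟨a - e, e + b, ⟨a, -e, ha, ?_, (sub_eq_add_neg a e).symm⟩,
            ⟨e, b, he, hb, rfl⟩, by rw [← add_assoc, sub_add_cancel]⟩
          exact mem_relNeg.2 (by simpa using he)) (by
          intro c
          obtain ⟨a, ha, ha'⟩ := hGH c
          obtain ⟨b, hb, hb'⟩ := hHK c
          exact ⟨0, 0, ⟨a, -a, ha, mem_relNeg.2 (by simpa using ha'), by simp⟩,
            ⟨b, -b, hb, mem_relNeg.2 (by simpa using hb'), by simp⟩, by simp⟩) m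
        obtain ⟨a, b, ha, hb, h⟩ := mem_relAdd.1 key
        rw [mem_relNeg, ← eq_neg_of_add_eq_zero_left h] at hb
        exact ⟨a, ha, hb⟩ }

/-- The set of classes of relations in a division system. -/
def Carrier (hS : IsDivisionSystem S) : Type v := Quotient hS.setoid

/-- The class of a relation. -/
def cls (hS : IsDivisionSystem S) (G : AddSubgroup (M × M)) (hG : G ∈ S) : hS.Carrier :=
  Quotient.mk hS.setoid ⟨G, hG⟩

variable (hS : IsDivisionSystem S)

theorem cls_eq_cls {G H : AddSubgroup (M × M)} {hG : G ∈ S} {hH : H ∈ S} :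
    hS.cls G hG = hS.cls H hH ↔ ∀ m, ∃ a, (m, a) ∈ G ∧ (m, a) ∈ H :=
  Quotient.eq (r := hS.setoid)

/-- Totality of the smaller relation suffices. Most ring axioms thus need only one inclusion between
relations. -/
theorem cls_eq_of_le {G H : AddSubgroup (M × M)} {hG : G ∈ S} {hH : H ∈ S} (h : G ≤ H) :
    hS.cls G hG = hS.cls H hH :=
  hS.cls_eq_cls.2 fun m => (hS.total G hG m).imp fun _ h' => ⟨h', h h'⟩

theorem ind {p : hS.Carrier → Prop} (h : ∀ G hG, p (hS.cls G hG)) (x : hS.Carrier) : p x :=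
  Quotient.inductionOn x fun G => h G.1 G.2

instance : Zero hS.Carrier := ⟨hS.cls _ hS.zero_mem⟩

instance : One hS.Carrier := ⟨hS.cls _ hS.one_mem⟩

instance : Add hS.Carrier where
  add := Quotient.map₂ (fun G H => ⟨relAdd G.1 H.1, hS.add_mem _ G.2 _ H.2⟩) (by
    intro G G' hG H H' hH m
    obtain ⟨a, ha, ha'⟩ := hG m
    obtain ⟨b, hb, hb'⟩ := hH m
    exact ⟨a + b, ⟨a, b, ha, hb, rfl⟩, ⟨a, b, ha', hb', rfl⟩⟩)

instance : Mul hS.Carrier where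
  mul := Quotient.map₂ (fun G H => ⟨relComp G.1 H.1, hS.comp_mem _ G.2 _ H.2⟩) (by
    intro G G' hG H H' hH m
    obtain ⟨a, ha, ha'⟩ := hG m
    obtain ⟨b, hb, hb'⟩ := hH a
    exact ⟨b, ⟨a, ha, hb⟩, ⟨a, ha', hb'⟩⟩)

instance : Neg hS.Carrier where
  neg := Quotient.map (fun G => ⟨relNeg G.1, hS.neg_mem _ G.2⟩) (by
    intro G G' hG m
    obtain ⟨a, ha, ha'⟩ := hG m
    exact ⟨-a, mem_relNeg.2 (by simpa using ha), mem_relNeg.2 (by simpa using ha')⟩)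

theorem cls_add_cls {G H : AddSubgroup (M × M)} (hG : G ∈ S) (hH : H ∈ S) :
    hS.cls G hG + hS.cls H hH = hS.cls (relAdd G H) (hS.add_mem _ hG _ hH) := rfl

theorem cls_mul_cls {G H : AddSubgroup (M × M)} (hG : G ∈ S) (hH : H ∈ S) :
    hS.cls G hG * hS.cls H hH = hS.cls (relComp G H) (hS.comp_mem _ hG _ hH) := rfl

theorem neg_cls {G : AddSubgroup (M × M)} (hG : G ∈ S) :
    -hS.cls G hG = hS.cls (relNeg G) (hS.neg_mem _ hG) := rfl

theorem zero_eq_cls : (0 : hS.Carrier) = hS.cls _ hS.zero_mem := rfl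

theorem one_eq_cls : (1 : hS.Carrier) = hS.cls _ hS.one_mem := rfl

theorem cls_eq_zero {G : AddSubgroup (M × M)} {hG : G ∈ S} :
    hS.cls G hG = 0 ↔ ∀ m, (m, 0) ∈ G := by
  rw [zero_eq_cls, cls_eq_cls]
  refine forall_congr' fun m => ⟨?_, fun h => ⟨0, h, by simp⟩⟩
  rintro ⟨a, ha, h⟩
  have : 0 = a := by simpa using h
  rwa [this]

protected theorem add_comm' (x y : hS.Carrier) : x + y = y + x := by
  induction x using hS.ind with | _ G hG
  induction y using hS.ind with | _ H hH
  rw [cls_add_cls, cls_add_cls]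
  apply cls_eq_of_le
  rintro ⟨m, _⟩ ⟨a, b, ha, hb, rfl⟩
  exact ⟨b, a, hb, ha, add_comm b a⟩

protected theorem zero_add' (x : hS.Carrier) : 0 + x = x := by
  induction x using hS.ind with | _ G hG
  rw [zero_eq_cls, cls_add_cls]
  apply cls_eq_of_le
  rintro ⟨m, c⟩ ⟨a, b, ha, hb, h⟩
  have ha' : 0 = a := by simpa using ha
  subst ha'
  have : b = c := by simpa using h
  rwa [← this]

protected theorem one_mul' (x : hS.Carrier) : 1 * x = x := by
  induction x using hS.ind with | _ G hG
  rw [one_eq_cls, cls_mul_cls]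
  apply cls_eq_of_le
  rintro ⟨m, c⟩ ⟨a, ha, hb⟩
  have ha' : m = a := by simpa using ha
  rwa [ha']

protected theorem mul_one' (x : hS.Carrier) : x * 1 = x := by
  induction x using hS.ind with | _ G hG
  rw [one_eq_cls, cls_mul_cls]
  apply cls_eq_of_le
  rintro ⟨m, c⟩ ⟨a, ha, hb⟩
  have hb' : a = c := by simpa using hb
  rwa [← hb']

instance : Ring hS.Carrier where
  add_assoc x y z := by
    induction x using hS.ind with | _ G hG
    induction y using hS.ind with | _ H hH
    induction z using hS.ind with | _ K hK
    simp only [cls_add_cls]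
    apply cls_eq_of_le
    rintro ⟨m, _⟩ ⟨_, c, ⟨a, b, ha, hb, rfl⟩, hc, rfl⟩
    exact ⟨a, b + c, ha, ⟨b, c, hb, hc, rfl⟩, (add_assoc a b c).symm⟩
  zero_add := hS.zero_add'
  add_zero x := (hS.add_comm' x 0).trans (hS.zero_add' x)
  add_comm := hS.add_comm'
  left_distrib x y z := by
    induction x using hS.ind with | _ G hG
    induction y using hS.ind with | _ H hH
    induction z using hS.ind with | _ K hK
    simp only [cls_add_cls, cls_mul_cls]
    apply cls_eq_of_le
    rintro ⟨m, _⟩ ⟨a, ha, b, c, hb, hc, rfl⟩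
    exact ⟨b, c, ⟨a, ha, hb⟩, ⟨a, ha, hc⟩, rfl⟩
  right_distrib x y z := by
    induction x using hS.ind with | _ G hG
    induction y using hS.ind with | _ H hH
    induction z using hS.ind with | _ K hK
    simp only [cls_add_cls, cls_mul_cls]
    -- The easy inclusion is the opposite one here: the sum of the composites lies in the composite
    -- of the sum, because `K` is additive.
    symm
    apply cls_eq_of_le
    rintro ⟨m, _⟩ ⟨b, c, ⟨a, ha, hb⟩, ⟨a', ha', hc⟩, rfl⟩
    exact ⟨a + a', ⟨a, a', ha, ha', rfl⟩, K.add_mem hb hc⟩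
  mul_assoc x y z := by
    induction x using hS.ind with | _ G hG
    induction y using hS.ind with | _ H hH
    induction z using hS.ind with | _ K hK
    simp only [cls_mul_cls]
    apply cls_eq_of_le
    rintro ⟨m, d⟩ ⟨b, ⟨a, ha, hb⟩, hd⟩
    exact ⟨a, ha, b, hb, hd⟩
  one_mul := hS.one_mul'
  mul_one := hS.mul_one'
  zero_mul x := by
    induction x using hS.ind with | _ G hG
    rw [zero_eq_cls, cls_mul_cls, ← zero_eq_cls, cls_eq_zero]
    exact fun m => ⟨0, by simp, G.zero_mem⟩
  mul_zero x := by
    induction x using hS.ind with | _ G hG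
    rw [zero_eq_cls, cls_mul_cls, ← zero_eq_cls, cls_eq_zero]
    exact fun m => (hS.total G hG m).imp fun a ha => ⟨ha, by simp⟩
  neg_add_cancel x := by
    induction x using hS.ind with | _ G hG
    rw [neg_cls, cls_add_cls, cls_eq_zero]
    intro m
    obtain ⟨a, ha⟩ := hS.total G hG m
    exact ⟨-a, a, mem_relNeg.2 (by simpa using ha), ha, neg_add_cancel a⟩
  nsmul := nsmulRec
  zsmul := zsmulRec

/-- The inverse relation gives the inverse class: totality of `G` and of `relInv G` puts the
identity graph inside each of the two composites. -/
theorem isUnit_or_eq_zero (x : hS.Carrier) : IsUnit x ∨ x = 0 := by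
  induction x using hS.ind with | _ G hG
  rcases hS.zero_le_or_inv_mem G hG with h | h
  · exact Or.inr (hS.cls_eq_zero.2 h)
  · refine Or.inl (isUnit_iff_exists.2 ⟨hS.cls _ h, ?_, ?_⟩)
    · rw [cls_mul_cls, one_eq_cls]
      symm
      apply cls_eq_of_le
      rintro ⟨m, c⟩ hmc
      have hmc' : m = c := by simpa using hmc
      subst hmc'
      exact (hS.total G hG m).imp fun a ha => ⟨ha, ha⟩
    · rw [cls_mul_cls, one_eq_cls]
      symm
      apply cls_eq_of_le
      rintro ⟨m, c⟩ hmc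
      have hmc' : m = c := by simpa using hmc
      subst hmc'
      exact (hS.total _ h m).imp fun a ha => ⟨ha, ha⟩

instance [Nontrivial M] : Nontrivial hS.Carrier := by
  refine ⟨1, 0, fun h => ?_⟩
  obtain ⟨m, hm⟩ := exists_ne (0 : M)
  rw [one_eq_cls, cls_eq_zero] at h
  exact hm (by simpa using h m)

/-- The division ring defined by a division system. -/
noncomputable abbrev divisionRing [Nontrivial M] : DivisionRing hS.Carrier :=
  DivisionRing.ofIsUnitOrEqZero hS.isUnit_or_eq_zero

end IsDivisionSystem

end AdditiveRelations

/-! The relations defined by matrices -/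

section FractionRelations

variable {R : Type u} [Ring R] {M : Type v} [AddCommGroup M] [Module Rᵐᵒᵖ M]

theorem matAct_apply {m n : ℕ} (A : Matrix (Fin m) (Fin n) R) (x : Fin m → M) (j : Fin n) :
    matAct M A x j = ∑ i, op (A i j) • x i := rfl

theorem rowAct_apply {n : ℕ} (a : Fin n → R) (x : M) (j : Fin n) :
    rowAct M a x j = op (a j) • x := rfl

theorem rowAct_sup_matAct_eq_top {m n : ℕ} {a : Fin n → R} {C : Matrix (Fin m) (Fin n) R} :
    (rowAct M a).range ⊔ (matAct M C).range = ⊤ ↔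
      ∀ v, ∃ x z, rowAct M a x + matAct M C z = v := by
  simp [AddSubgroup.eq_top_iff', AddSubgroup.mem_sup]

variable (R M) in
/-- The additive relations `{(m, a) | m x - a y ∈ M^n C}` on `M`, where `C` is an
`n × (n + 1)` matrix whose image together with that of `y` spans `M^(n+1)`. -/
def fractionRelations : Set (AddSubgroup (M × M)) :=
  {G | ∃ (n : ℕ) (C : Matrix (Fin n) (Fin (n + 1)) R) (x y : Fin (n + 1) → R),
    (rowAct M y).range ⊔ (matAct M C).range = ⊤ ∧
    ∀ m a, (m, a) ∈ G ↔ rowAct M x m - rowAct M y a ∈ (matAct M C).range}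

/-- Arbitrary finite index types allow block matrices to be indexed by sum types, without arithmetic
in `Fin`. -/
theorem mem_fractionRelations_of_fintype {ι κ : Type} [Fintype ι] [Fintype κ]
    (hcard : Fintype.card κ = Fintype.card ι + 1) (C : ι → κ → R) (x y : κ → R)
    (hspan : ∀ v : κ → M, ∃ (a : M) (z : ι → M), ∀ k, op (y k) • a + ∑ i, op (C i k) • z i = v k)
    {G : AddSubgroup (M × M)}
    (hG : ∀ m a, (m, a) ∈ G ↔
      ∃ z : ι → M, ∀ k, ∑ i, op (C i k) • z i = op (x k) • m - op (y k) • a) :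
    G ∈ fractionRelations R M := by
  let e := Fintype.equivFin ι
  let f := (Fintype.equivFin κ).trans (finCongr hcard)
  have hsum : ∀ (z : Fin (Fintype.card ι) → M) (k : κ),
      ∑ i, op (C (e.symm i) k) • z i = ∑ i, op (C i k) • z (e i) := fun z k =>
    Fintype.sum_equiv e.symm _ _ (by simp)
  refine ⟨Fintype.card ι, Matrix.of fun i k => C (e.symm i) (f.symm k), x ∘ f.symm, y ∘ f.symm,
    rowAct_sup_matAct_eq_top.2 fun v => ?_, fun m a => (hG m a).trans ?_⟩
  · obtain ⟨a, z, h⟩ := hspan (v ∘ f)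
    refine ⟨a, z ∘ e.symm, funext fun k => ?_⟩
    have := h (f.symm k)
    simpa [matAct_apply, rowAct_apply, hsum] using this
  · constructor
    · rintro ⟨z, hz⟩
      refine ⟨z ∘ e.symm, funext fun k => ?_⟩
      simpa [matAct_apply, rowAct_apply, hsum] using hz (f.symm k)
    · rintro ⟨z, hz⟩
      refine ⟨z ∘ e, fun k => ?_⟩
      have := congrFun hz (f k)
      simpa [matAct_apply, rowAct_apply, hsum] using this

theorem mem_matAct_range {m n : ℕ} {C : Matrix (Fin m) (Fin n) R} {v : Fin n → M} :
    v ∈ (matAct M C).range ↔ ∃ z : Fin m → M, ∀ k, ∑ i, op (C i k) • z i = v k := by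
  simp only [AddMonoidHom.mem_range, funext_iff, matAct_apply]

theorem graph_mem_fractionRelations (r : R) :
    (DistribSMul.toAddMonoidHom M (op r)).graph ∈ fractionRelations R M := by
  refine mem_fractionRelations_of_fintype (ι := Empty) (κ := Unit) (by simp) (fun _ _ => 0)
    (fun _ => r) (fun _ => 1) (fun v => ⟨v (), 0, fun _ => by simp⟩) fun m a => ?_
  simp [eq_comm, sub_eq_zero]

theorem relNeg_mem_fractionRelations {G : AddSubgroup (M × M)}
    (hG : G ∈ fractionRelations R M) : relNeg G ∈ fractionRelations R M := by
  obtain ⟨n, C, x, y, h, hG⟩ := hG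
  refine ⟨n, C, -x, y, h, fun m a => ?_⟩
  rw [mem_relNeg, hG, ← neg_mem_iff]
  convert Iff.rfl using 2
  ext k
  simp [rowAct_apply]
  abel

/-! ### Composites and sums of fraction relations. -/

/-- Two relations with denominators `y`, `y'` are glued along the extra row `(y, -w)`. -/
theorem glue_span {n n' : ℕ} {C : Matrix (Fin n) (Fin (n + 1)) R}
    {C' : Matrix (Fin n') (Fin (n' + 1)) R} {y : Fin (n + 1) → R} {y' w : Fin (n' + 1) → R}
    (h : (rowAct M y).range ⊔ (matAct M C).range = ⊤)
    (h' : (rowAct M y').range ⊔ (matAct M C').range = ⊤)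
    (v : Fin (n + 1) ⊕ Fin (n' + 1) → M) :
    ∃ (a c : M) (z : Fin n → M) (z' : Fin n' → M),
      (∀ k, op (y k) • c + ∑ i, op (C i k) • z i = v (Sum.inl k)) ∧
      ∀ k, op (y' k) • a - op (w k) • c + ∑ i, op (C' i k) • z' i = v (Sum.inr k) := by
  obtain ⟨c, z, hz⟩ := rowAct_sup_matAct_eq_top.1 h (v ∘ Sum.inl)
  -- The system is triangular: `c` is fixed by the left block, and its contribution `-w c` to the
  -- right block is compensated in the target.
  obtain ⟨a, z', hz'⟩ := rowAct_sup_matAct_eq_top.1 h' (v ∘ Sum.inr + rowAct M w c)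
  refine ⟨a, c, z, z', fun k => congrFun hz k, fun k => ?_⟩
  have := congrFun hz' k
  simp only [Pi.add_apply, rowAct_apply, matAct_apply, Function.comp_apply] at this
  rw [sub_add_eq_add_sub, this, add_sub_cancel_right]

/-- The rows `(C, 0)`, `(0, C')` and `(y, -w)`. -/
def glueRows {n n' : ℕ} (C : Matrix (Fin n) (Fin (n + 1)) R)
    (C' : Matrix (Fin n') (Fin (n' + 1)) R) (y : Fin (n + 1) → R) (w : Fin (n' + 1) → R) :
    (Fin n ⊕ Fin n') ⊕ Unit → Fin (n + 1) ⊕ Fin (n' + 1) → R :=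
  Sum.elim (Sum.elim (fun i => Sum.elim (C i) 0) (fun i => Sum.elim 0 (C' i)))
    (fun _ => Sum.elim y (-w))

theorem card_glue (n n' : ℕ) : Fintype.card (Fin (n + 1) ⊕ Fin (n' + 1)) =
    Fintype.card ((Fin n ⊕ Fin n') ⊕ Unit) + 1 := by
  simp
  omega

/-- The intermediate value `a` becomes the coefficient of the glued row `(y, -x')`. The two blocks
then read `z C = m x - a y` and `z' C' = a x' - b y'`. -/
theorem relComp_mem_fractionRelations {G H : AddSubgroup (M × M)}
    (hG : G ∈ fractionRelations R M) (hH : H ∈ fractionRelations R M) :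
    relComp G H ∈ fractionRelations R M := by
  obtain ⟨n, C, x, y, h, hG⟩ := hG
  obtain ⟨n', C', x', y', h', hH⟩ := hH
  refine mem_fractionRelations_of_fintype (card_glue n n') (glueRows C C' y x')
    (Sum.elim x 0) (Sum.elim 0 y') (fun v => ?_) fun m b => ?_
  · obtain ⟨a, c, z, z', hz, hz'⟩ := glue_span (w := x') h h' v
    refine ⟨a, Sum.elim (Sum.elim z z') fun _ => c, ?_⟩
    rintro (k | k)
    · simp [glueRows, ← hz k, add_comm]
    · simp only [glueRows, ← hz' k]
      simp
      abel
  · simp only [mem_relComp, hG, hH, mem_matAct_range]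
    constructor
    · rintro ⟨a, ⟨z, hz⟩, z', hz'⟩
      refine ⟨Sum.elim (Sum.elim z z') fun _ => a, ?_⟩
      rintro (k | k)
      · simp [glueRows, hz k, rowAct_apply]
      · simp [glueRows, hz' k, rowAct_apply]
        abel
    · rintro ⟨z, hz⟩
      refine ⟨z (Sum.inr ()), ⟨fun i => z (Sum.inl (Sum.inl i)), fun k => ?_⟩,
        fun i => z (Sum.inl (Sum.inr i)), fun k => ?_⟩
      · have := hz (Sum.inl k)
        simp [glueRows] at this
        simp [rowAct_apply, ← this]
      · have := hz (Sum.inr k)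
        simp [glueRows] at this
        simp [rowAct_apply, sub_eq_add_neg, ← this]

/-- With `a` the value under `G` and `b` the sum, the value under `H` is `b - a`. The right block
`z' C' = m x' - (b - a) y'` is obtained from the glued row `(y, -y')` with coefficient `a`. -/
theorem relAdd_mem_fractionRelations {G H : AddSubgroup (M × M)}
    (hG : G ∈ fractionRelations R M) (hH : H ∈ fractionRelations R M) :
    relAdd G H ∈ fractionRelations R M := by
  obtain ⟨n, C, x, y, h, hG⟩ := hG
  obtain ⟨n', C', x', y', h', hH⟩ := hH
  refine mem_fractionRelations_of_fintype (card_glue n n') (glueRows C C' y y')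
    (Sum.elim x x') (Sum.elim 0 y') (fun v => ?_) fun m b => ?_
  · obtain ⟨a, c, z, z', hz, hz'⟩ := glue_span (w := y') h h' v
    refine ⟨a, Sum.elim (Sum.elim z z') fun _ => c, ?_⟩
    rintro (k | k)
    · simp [glueRows, ← hz k, add_comm]
    · simp only [glueRows, ← hz' k]
      simp
      abel
  · simp only [mem_relAdd, hG, hH, mem_matAct_range]
    constructor
    · rintro ⟨a, d, ⟨z, hz⟩, ⟨z', hz'⟩, rfl⟩
      refine ⟨Sum.elim (Sum.elim z z') fun _ => a, ?_⟩
      rintro (k | k)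
      · simp [glueRows, hz k, rowAct_apply]
      · simp [glueRows, hz' k, rowAct_apply]
        abel
    · rintro ⟨z, hz⟩
      refine ⟨z (Sum.inr ()), b - z (Sum.inr ()), ⟨fun i => z (Sum.inl (Sum.inl i)), fun k => ?_⟩,
        ⟨fun i => z (Sum.inl (Sum.inr i)), fun k => ?_⟩, by simp⟩
      · have := hz (Sum.inl k)
        simp [glueRows] at this
        simp [rowAct_apply, ← this]
      · have := hz (Sum.inr k)
        simp [glueRows] at this
        rw [← sub_eq_add_neg, sub_eq_iff_eq_add] at this
        simp [rowAct_apply, this]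
        abel

/-! ### The two conditions make the fraction relations a division system. -/

theorem matAct_range_ne_top (hup : NoSurjectionUp R M) {n : ℕ}
    (C : Matrix (Fin n) (Fin (n + 1)) R) : (matAct M C).range ≠ ⊤ := fun h =>
  hup n C (AddMonoidHom.range_eq_top.1 h)

theorem not_rowAct_range_le (hup : NoSurjectionUp R M) {n : ℕ}
    {C : Matrix (Fin n) (Fin (n + 1)) R} {y : Fin (n + 1) → R}
    (h : (rowAct M y).range ⊔ (matAct M C).range = ⊤) :
    ¬ (rowAct M y).range ≤ (matAct M C).range := fun hle =>
  matAct_range_ne_top hup C (by rwa [sup_eq_right.2 hle] at h)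

theorem isDivisionSystem_fractionRelations (hup : NoSurjectionUp R M) (hdi : RowDichotomy R M) :
    IsDivisionSystem (fractionRelations R M) where
  total := by
    rintro G ⟨n, C, x, y, h, hG⟩ m
    obtain ⟨a, z, haz⟩ := rowAct_sup_matAct_eq_top.1 h (rowAct M x m)
    exact ⟨a, (hG m a).2 ⟨z, by rw [← haz, add_sub_cancel_left]⟩⟩
  zero_le_or_inv_mem := by
    rintro G ⟨n, C, x, y, h, hG⟩
    by_cases hx : (rowAct M x).range ≤ (matAct M C).range
    · left
      intro m
      rw [hG, map_zero, sub_zero]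
      exact hx ⟨m, rfl⟩
    · right
      have hy := not_rowAct_range_le hup h
      -- The denominator `y` spans with `I` and, by `(*)`, is not contained in it, so it rules out
      -- alternative (b).
      rcases hdi n C with hC | hC
      · refine ⟨n, C, y, x, hC x hx, fun m a => ?_⟩
        rw [mem_relInv, hG, ← neg_mem_iff, neg_sub]
      · exact absurd h (hC y hy)
  top_notMem := by
    rintro ⟨n, C, x, y, h, hG⟩
    refine not_rowAct_range_le hup h ?_
    rintro _ ⟨a, rfl⟩
    have := (hG 0 a).1 (AddSubgroup.mem_top _)
    rwa [map_zero, zero_sub, neg_mem_iff] at this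
  add_mem _ hG _ hH := relAdd_mem_fractionRelations hG hH
  neg_mem _ hG := relNeg_mem_fractionRelations hG
  comp_mem _ hG _ hH := relComp_mem_fractionRelations hG hH
  zero_mem := by
    convert graph_mem_fractionRelations (M := M) (0 : R) using 2
    ext
    simp
  one_mem := by
    convert graph_mem_fractionRelations (M := M) (1 : R) using 2
    ext
    simp

/-! ### Embedding `R` into the division ring. -/

-- A relation is determined by its matrix data, which live in the universe of `R`. The division ring
-- can therefore be moved there, whatever the universe of `M`.
variable (R M) in
theorem small_fractionRelations : Small.{u} (fractionRelations R M) := by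
  choose n C x y h hG using fun G : fractionRelations R M => G.2
  refine small_of_injective (β := Σ n : ℕ,
    Matrix (Fin n) (Fin (n + 1)) R × (Fin (n + 1) → R) × (Fin (n + 1) → R))
    (f := fun G => ⟨n G, C G, x G, y G⟩) fun G H hGH => ?_
  -- Stated for arbitrary `p = q`, so that the equality of dependent tuples can be eliminated by
  -- `rfl`.
  have key : ∀ p q : Σ n : ℕ,
      Matrix (Fin n) (Fin (n + 1)) R × (Fin (n + 1) → R) × (Fin (n + 1) → R), p = q → ∀ m a,
      (rowAct M p.2.2.1 m - rowAct M p.2.2.2 a ∈ (matAct M p.2.1).range ↔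
        rowAct M q.2.2.1 m - rowAct M q.2.2.2 a ∈ (matAct M q.2.1).range) := by
    rintro p _ rfl m a
    rfl
  refine Subtype.ext (AddSubgroup.ext fun ⟨m, a⟩ => ?_)
  rw [hG, hG]
  exact key _ _ hGH m a

/-- The homomorphism from `R` to the division ring of its fraction relations. -/
def toFractions (hup : NoSurjectionUp R M) (hdi : RowDichotomy R M) :
    R →+* (isDivisionSystem_fractionRelations hup hdi).Carrier where
  toFun r := (isDivisionSystem_fractionRelations hup hdi).cls _ (graph_mem_fractionRelations r)
  map_zero' := by
    rw [IsDivisionSystem.cls_eq_zero]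
    simp
  map_one' := by
    rw [IsDivisionSystem.one_eq_cls]
    apply IsDivisionSystem.cls_eq_of_le
    rintro ⟨m, a⟩ h
    simpa using h
  map_add' r s := by
    rw [IsDivisionSystem.cls_add_cls]
    apply IsDivisionSystem.cls_eq_of_le
    rintro ⟨m, a⟩ h
    exact ⟨op r • m, op s • m, by simp, by simp, by simpa [add_smul] using h⟩
  map_mul' r s := by
    rw [IsDivisionSystem.cls_mul_cls]
    apply IsDivisionSystem.cls_eq_of_le
    rintro ⟨m, a⟩ h
    exact ⟨op r • m, by simp, by simpa [mul_smul] using h⟩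

theorem toFractions_injective [Nontrivial M] (hup : NoSurjectionUp R M)
    (hdi : RowDichotomy R M)
    (hdiv : ∀ r : R, r ≠ 0 → Function.Surjective (fun x : M => op r • x)) :
    Function.Injective (toFractions hup hdi) := by
  refine (injective_iff_map_eq_zero _).2 fun r hr => ?_
  by_contra hne
  obtain ⟨m, hm⟩ := exists_ne (0 : M)
  obtain ⟨a, rfl⟩ := hdiv r hne m
  have := (IsDivisionSystem.cls_eq_zero _).1 hr a
  exact hm (by simpa using this)

theorem embedsInDivisionRing [Nontrivial M] (hup : NoSurjectionUp R M)
    (hdi : RowDichotomy R M)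
    (hdiv : ∀ r : R, r ≠ 0 → Function.Surjective (fun x : M => op r • x)) :
    EmbedsInDivisionRing R := by
  have hS := isDivisionSystem_fractionRelations hup hdi
  have := small_fractionRelations R M
  have : Small.{u} hS.Carrier :=
    small_of_surjective (f := Quotient.mk hS.setoid) Quotient.mk_surjective
  let _ : DivisionRing hS.Carrier := hS.divisionRing
  exact ⟨Shrink.{u} hS.Carrier, inferInstance,
    (Shrink.ringEquiv hS.Carrier).symm.toRingHom.comp (toFractions hup hdi),
    (Shrink.ringEquiv hS.Carrier).symm.injective.comp (toFractions_injective hup hdi hdiv)⟩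

end FractionRelations

/-! Square matrices acting non-surjectively -/

section NonSurjective

variable {R : Type u} [Ring R] {M : Type v} [AddCommGroup M] [Module Rᵐᵒᵖ M]

theorem mem_nonSurj {n : ℕ} {A : Matrix (Fin n) (Fin n) R} :
    A ∈ nonSurj R M n ↔ ¬ Function.Surjective (matAct M A) := Iff.rfl

theorem matAct_mul {l m n : ℕ} (A : Matrix (Fin l) (Fin m) R) (B : Matrix (Fin m) (Fin n) R)
    (x : Fin l → M) : matAct M (A * B) x = matAct M B (matAct M A x) := by
  ext j
  simp only [matAct_apply, Matrix.mul_apply, Finset.op_sum, Finset.sum_smul, Finset.smul_sum, op_mul,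
    mul_smul]
  exact Finset.sum_comm

theorem matAct_one {n : ℕ} (x : Fin n → M) :
    matAct M (1 : Matrix (Fin n) (Fin n) R) x = x := by
  ext j
  rw [matAct_apply, Finset.sum_eq_single j]
  · simp
  · intro i _ hij
    simp [Matrix.one_apply_ne hij]
  · simp

theorem surjective_matAct_of_mul {l m n : ℕ} {A : Matrix (Fin l) (Fin m) R}
    {B : Matrix (Fin m) (Fin n) R} (h : Function.Surjective (matAct M (A * B))) :
    Function.Surjective (matAct M B) := fun v => by
  obtain ⟨x, rfl⟩ := h v
  exact ⟨_, (matAct_mul A B x).symm⟩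

theorem matAct_diagSum {m n : ℕ} (A : Matrix (Fin m) (Fin m) R) (B : Matrix (Fin n) (Fin n) R)
    (x : Fin m → M) (y : Fin n → M) :
    matAct M (diagSum A B) (Fin.append x y) = Fin.append (matAct M A x) (matAct M B y) := by
  ext j
  refine Fin.addCases (fun j => ?_) (fun j => ?_) j <;>
    simp [matAct_apply, diagSum, Fin.sum_univ_add]

theorem surjective_matAct_diagSum {m n : ℕ} {A : Matrix (Fin m) (Fin m) R}
    {B : Matrix (Fin n) (Fin n) R} :
    Function.Surjective (matAct M (diagSum A B)) ↔
      Function.Surjective (matAct M A) ∧ Function.Surjective (matAct M B) := by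
  have happ : ∀ w : Fin (m + n) → M,
      w = Fin.append (fun i => w (Fin.castAdd n i)) (fun i => w (Fin.natAdd m i)) := fun w =>
    Fin.append_castAdd_natAdd.symm
  constructor
  · intro h
    refine ⟨fun v => ?_, fun v => ?_⟩
    · obtain ⟨w, hw⟩ := h (Fin.append v 0)
      rw [happ w, matAct_diagSum] at hw
      exact ⟨_, funext fun j => by simpa using congrFun hw (Fin.castAdd n j)⟩
    · obtain ⟨w, hw⟩ := h (Fin.append 0 v)
      rw [happ w, matAct_diagSum] at hw
      exact ⟨_, funext fun j => by simpa using congrFun hw (Fin.natAdd m j)⟩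
  · rintro ⟨hA, hB⟩ w
    obtain ⟨x, hx⟩ := hA fun i => w (Fin.castAdd n i)
    obtain ⟨y, hy⟩ := hB fun i => w (Fin.natAdd m i)
    exact ⟨Fin.append x y, by rw [matAct_diagSum, hx, hy, ← happ w]⟩

theorem closedDiagSum_nonSurj : ClosedDiagSum (nonSurj R M) := fun _ _ _ _ hA h =>
  hA (surjective_matAct_diagSum.1 h).1

theorem primeDiagSum_nonSurj : PrimeDiagSum (nonSurj R M) := by
  intro m n A B h
  rw [mem_nonSurj, surjective_matAct_diagSum, not_and_or] at h
  exact h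

theorem omitsOne_nonSurj : OmitsOne (nonSurj R M) := fun h => h fun v => ⟨v, matAct_one v⟩

theorem cancelsOne_nonSurj : CancelsOne (nonSurj R M) := fun _ _ h =>
  (primeDiagSum_nonSurj _ _ _ _ h).resolve_right omitsOne_nonSurj

theorem mul_mem_nonSurj {n : ℕ} {A E F : Matrix (Fin n) (Fin n) R} (hEF : E * F = 1)
    (hA : A ∈ nonSurj R M n) : A * E ∈ nonSurj R M n := by
  intro h
  refine hA ?_
  have hF : Function.Surjective (matAct M F) :=
    surjective_matAct_of_mul (A := E) (by rw [hEF]; exact fun v => ⟨v, matAct_one v⟩)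
  have hA' : A = A * E * F := by rw [Matrix.mul_assoc, hEF, Matrix.mul_one]
  rw [hA']
  intro v
  obtain ⟨w, rfl⟩ := hF v
  obtain ⟨x, rfl⟩ := h w
  exact ⟨x, matAct_mul _ _ x⟩

theorem closedRightElementary_nonSurj : ClosedRightElementary (nonSurj R M) := by
  intro n A i j hij hA
  have h0 : Matrix.single i j (1 : R) * Matrix.single i j (1 : R) = 0 := by
    simp [hij.symm]
  refine ⟨mul_mem_nonSurj (F := 1 - Matrix.single i j (1 : R)) ?_ hA,
    mul_mem_nonSurj (F := 1 + Matrix.single i j (1 : R)) ?_ hA⟩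
  · simp [add_mul, mul_sub, h0]
  · simp [sub_mul, mul_add, h0]

theorem containsNonfull_nonSurj_iff :
    ContainsNonfull (nonSurj R M) ↔ NoSurjectionUp R M := by
  constructor
  · intro h n C hC
    -- The left factor is the identity with a zero row beneath it, so the product is `C` with a zero
    -- row added and has the same image.
    refine h n (Matrix.of fun i j => if i = j.castSucc then 1 else 0) C fun v => ?_
    obtain ⟨x, rfl⟩ := hC v
    refine ⟨Fin.snoc x 0, ?_⟩
    rw [matAct_mul]
    congr 1
    ext j
    rw [matAct_apply, Finset.sum_eq_single j.castSucc]
    · simp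
    · intro i _ hij
      simp [hij]
    · simp
  · exact fun h n B C hBC => h n C (surjective_matAct_of_mul hBC)

/-! ### Determinantal sums. -/

theorem matAct_eq_rowAct_add {m n : ℕ} (A : Matrix (Fin (m + 1)) (Fin n) R) (r : Fin (m + 1))
    (x : Fin (m + 1) → M) :
    matAct M A x = rowAct M (A r) (x r) +
      matAct M (A.submatrix r.succAbove id) (fun i => x (r.succAbove i)) := by
  ext j
  simp [matAct_apply, rowAct_apply, Fin.sum_univ_succAbove _ r]

theorem surjective_matAct_iff_sup_eq_top {m n : ℕ} (A : Matrix (Fin (m + 1)) (Fin n) R)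
    (r : Fin (m + 1)) : Function.Surjective (matAct M A) ↔
      (rowAct M (A r)).range ⊔ (matAct M (A.submatrix r.succAbove id)).range = ⊤ := by
  rw [rowAct_sup_matAct_eq_top]
  refine forall_congr' fun v => ⟨?_, ?_⟩
  · rintro ⟨x, rfl⟩
    exact ⟨_, _, (matAct_eq_rowAct_add A r x).symm⟩
  · rintro ⟨x, z, rfl⟩
    exact ⟨Fin.insertNth r x z, by simp [matAct_eq_rowAct_add A r]⟩

theorem closedNablaRow_nonSurj (hdi : RowDichotomy R M) : ClosedNablaRow (nonSurj R M) := by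
  rintro (_ | n) A B r hAB hA hB
  · exact r.elim0
  have hBsub : B.submatrix r.succAbove id = A.submatrix r.succAbove id := by
    ext i j
    exact (hAB _ _ (Fin.succAbove_ne r i)).symm
  have hNsub : (nablaRow A B r).submatrix r.succAbove id = A.submatrix r.succAbove id := by
    ext i j
    simp [nablaRow]
  have hNr : ∀ x : M, rowAct M (nablaRow A B r r) x = rowAct M (A r) x + rowAct M (B r) x := by
    intro x
    ext j
    simp [nablaRow, rowAct_apply, add_smul]
  rw [mem_nonSurj, surjective_matAct_iff_sup_eq_top _ r] at hA hB ⊢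
  rw [hBsub] at hB
  rw [hNsub]
  set C := A.submatrix r.succAbove id
  intro hN
  have hC : (matAct M C).range ≠ ⊤ := fun h => hA (by rw [h, sup_top_eq])
  have hNC : ¬ (rowAct M (nablaRow A B r r)).range ≤ (matAct M C).range := fun h =>
    hC (by rwa [sup_eq_right.2 h] at hN)
  -- Under (a), the non-spanning rows of `A` and `B` map into `I`, hence so does their sum. Under
  -- (b), the summed row, not mapping into `I`, cannot span.
  rcases hdi n C with h | h
  · have hA' := not_not.1 (mt (h (A r)) hA)
    have hB' := not_not.1 (mt (h (B r)) hB)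
    refine hNC ?_
    rintro _ ⟨x, rfl⟩
    rw [hNr]
    exact add_mem (hA' ⟨x, rfl⟩) (hB' ⟨x, rfl⟩)
  · exact h _ hNC hN

/-- The bordered matrix with first row `u`, first column below it `b`, and `A` as the remaining
block. -/
def border {n : ℕ} (u : Fin (n + 1) → R) (b : Fin n → R) (A : Matrix (Fin n) (Fin n) R) :
    Matrix (Fin (n + 1)) (Fin (n + 1)) R :=
  Matrix.of (Fin.cons u fun i => Fin.cons (b i) (A i))

theorem matAct_border_zero {n : ℕ} (u : Fin (n + 1) → R) (b : Fin n → R)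
    (A : Matrix (Fin n) (Fin n) R) (x : Fin (n + 1) → M) :
    matAct M (border u b A) x 0 = op (u 0) • x 0 + ∑ i, op (b i) • x i.succ := by
  simp [matAct_apply, border, Fin.sum_univ_succ]

theorem matAct_border_succ {n : ℕ} (u : Fin (n + 1) → R) (b : Fin n → R)
    (A : Matrix (Fin n) (Fin n) R) (x : Fin (n + 1) → M) (j : Fin n) :
    matAct M (border u b A) x j.succ =
      op (u j.succ) • x 0 + matAct M A (fun i => x i.succ) j := by
  simp [matAct_apply, border, Fin.sum_univ_succ]

/-- Closure under row sums gives closure under column sums, by bordering. -/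
theorem closedNablaCol_nonSurj (hrow : ClosedNablaRow (nonSurj R M)) :
    ClosedNablaCol (nonSurj R M) := by
  intro n A B r hAB hA hB hN
  let b : Fin n → R := fun i => B i r
  -- Both matrices have lower rows `(b, A)`, where `b` is the `r`-th column of `B`. With top row
  -- `e_0`, surjectivity would force that of `A`. With top row `-e_(r+1)`, column `0` is `b` under a
  -- zero, so it would force that of `B`.
  have h := hrow (n + 1) (border (Pi.single 0 1) b A) (border (-Pi.single r.succ 1) b A) 0
    (fun i j hi => by
      obtain ⟨i, rfl⟩ := Fin.exists_succ_eq.2 hi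
      rfl)
    (fun hs => hA fun v => by
      obtain ⟨x, hx⟩ := hs (Fin.cons 0 v)
      refine ⟨fun i => x i.succ, funext fun j => ?_⟩
      have := congrFun hx j.succ
      rw [matAct_border_succ] at this
      simpa using this)
    (fun hs => hB fun v => by
      obtain ⟨x, hx⟩ := hs (Fin.cons (v r) v)
      refine ⟨fun i => x i.succ, funext fun j => ?_⟩
      by_cases hj : j = r
      · subst hj
        have := congrFun hx 0
        rw [matAct_border_zero] at this
        simpa [matAct_apply, b] using this
      · have := congrFun hx j.succ
        rw [matAct_border_succ] at this
        simpa [matAct_apply, hj, ← hAB _ j hj] using this)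
  refine h fun w => ?_
  have hrow' : nablaRow (border (Pi.single 0 1) b A) (border (-Pi.single r.succ 1) b A) 0 =
      border (Pi.single 0 1 - Pi.single r.succ 1) b A := by
    ext i j
    refine Fin.cases ?_ (fun i => ?_) i
    · simp [nablaRow, border, sub_eq_add_neg]
    · simp [nablaRow, border]
  rw [hrow']
  -- In the summed matrix, with top row `e_0 - e_(r+1)`, adding column `0` to column `r + 1` leaves
  -- `nablaCol A B r` below a row `e_0`. The target is adjusted by the same column operation, and
  -- coordinate `0` then determines the first entry of the preimage.
  obtain ⟨x, hx⟩ := hN fun j => w j.succ + if j = r then w 0 else 0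
  refine ⟨Fin.cons (w 0 - ∑ i, op (b i) • x i) x, funext fun j => ?_⟩
  refine Fin.cases ?_ (fun j => ?_) j
  · rw [matAct_border_zero]
    simp
  · rw [matAct_border_succ]
    have hj := congrFun hx j
    by_cases hjr : j = r
    · subst hjr
      simp only [matAct_apply, nablaCol, Matrix.updateCol_self, op_add, add_smul,
        Finset.sum_add_distrib, if_true] at hj
      rw [← eq_sub_iff_add_eq] at hj
      simp [matAct_apply, hj, b]
    · simp only [matAct_apply, nablaCol, Matrix.updateCol_ne hjr, if_neg hjr, add_zero] at hj
      simp [matAct_apply, hj, hjr]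

theorem isPrimeMatrixIdeal_nonSurj (hup : NoSurjectionUp R M) (hdi : RowDichotomy R M) :
    IsPrimeMatrixIdeal (nonSurj R M) where
  containsNonfull := containsNonfull_nonSurj_iff.2 hup
  closedDiagSum := closedDiagSum_nonSurj
  closedNablaCol := closedNablaCol_nonSurj (closedNablaRow_nonSurj hdi)
  closedNablaRow := closedNablaRow_nonSurj hdi
  cancelsOne := cancelsOne_nonSurj
  omitsOne := omitsOne_nonSurj
  primeDiagSum := primeDiagSum_nonSurj

end NonSurjective

end PrimeMatrixIdeals

theorem lemmaL {R : Type u} [Ring R] {M : Type v} [AddCommGroup M] [Module Rᵐᵒᵖ M]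
    [Nontrivial M] :
    (PrimeMatrixIdeals.ClosedDiagSum (PrimeMatrixIdeals.nonSurj R M) ∧
      PrimeMatrixIdeals.CancelsOne (PrimeMatrixIdeals.nonSurj R M) ∧
      PrimeMatrixIdeals.OmitsOne (PrimeMatrixIdeals.nonSurj R M) ∧
      PrimeMatrixIdeals.PrimeDiagSum (PrimeMatrixIdeals.nonSurj R M) ∧
      PrimeMatrixIdeals.ClosedRightElementary (PrimeMatrixIdeals.nonSurj R M)) ∧
    (PrimeMatrixIdeals.ContainsNonfull (PrimeMatrixIdeals.nonSurj R M) ↔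
      PrimeMatrixIdeals.NoSurjectionUp R M) ∧
    (PrimeMatrixIdeals.RowDichotomy R M →
      PrimeMatrixIdeals.ClosedNablaRow (PrimeMatrixIdeals.nonSurj R M)) ∧
    (PrimeMatrixIdeals.NoSurjectionUp R M → PrimeMatrixIdeals.RowDichotomy R M →
      PrimeMatrixIdeals.IsPrimeMatrixIdeal (PrimeMatrixIdeals.nonSurj R M)) ∧
    (PrimeMatrixIdeals.NoSurjectionUp R M → PrimeMatrixIdeals.RowDichotomy R M →
      (∀ r : R, r ≠ 0 → Function.Surjective (fun x : M => MulOpposite.op r • x)) →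
      PrimeMatrixIdeals.EmbedsInDivisionRing R) :=
  ⟨⟨PrimeMatrixIdeals.closedDiagSum_nonSurj, PrimeMatrixIdeals.cancelsOne_nonSurj,
      PrimeMatrixIdeals.omitsOne_nonSurj, PrimeMatrixIdeals.primeDiagSum_nonSurj,
      PrimeMatrixIdeals.closedRightElementary_nonSurj⟩,
    PrimeMatrixIdeals.containsNonfull_nonSurj_iff, PrimeMatrixIdeals.closedNablaRow_nonSurj,
    PrimeMatrixIdeals.isPrimeMatrixIdeal_nonSurj, PrimeMatrixIdeals.embedsInDivisionRing⟩
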